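/- Let $c=1/33$ and $d=2^{-15}/100$. Let $n\ge 1$ and let $A:\mathbb{R}\to M_{n\times n}(\mathbb{R})$ be a continuous matrix function such that $\|A(t)e_i\|=1$ for all $t\in\mathbb{R}$ and $1\le i\le n$, where $\|\cdot\|$ is the Euclidean norm on $\mathbb{R}^n$ and $e_1,\dots,e_n$ is the standard basis. Put $\Lambda=\sup_{t\in\mathbb{R}}\|A(t)\|$, where $\|A(t)\|$ is the operator norm with respect to the Euclidean norm. Then there exist an integer $m\ge dn/\Lambda^4$ and $m$-dimensional subspaces $U(t)\subset\mathbb{R}^n$, $t\in\mathbb{R}$, such that the orthogonal projection onto $U(t)$ depends continuously on $t$, and $$\|A(t)v\|\ge c\|v\|\qquad\text{for all } t\in\mathbb{R},\ v\in U(t).$$ Furthermore, if $n\ge 2$, the $U(t)$ can be chosen so that in addition each $U(t)$ is a quadratic convex combination of disjoint basis vectors, that is: for every $t$ there are disjoint sets $\{i_1<\dots<i_m\}$ and $\{j_1<\dots<j_m\}$ of indices in $\{1,\dots,n\}$ and $\lambda\in[0,1]$ such that $U(t)$ is spanned by the vectors $\lambda^{1/2}e_{i_k}+(1-\lambda)^{1/2}e_{j_k}$,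 $k=1,\dots,m$. -/

import Mathlib

/-- `U` is a quadratic convex combination of disjoint basis vectors, with `m` generators:
there are disjoint index sets `{i 0 < ⋯ < i (m - 1)}` and `{j 0 < ⋯ < j (m - 1)}` (given by their
increasing enumerations) and `lam ∈ [0, 1]` such that `U` is the span of the vectors
`√lam • e_{i k} + √(1 - lam) • e_{j k}`. -/
def IsQuadraticConvexCombination {n : ℕ} (m : ℕ)
    (U : Submodule ℝ (EuclideanSpace ℝ (Fin n))) : Prop :=
  ∃ (i j : Fin m ↪o Fin n) (lam : ℝ),
    Disjoint (Set.range i) (Set.range j) ∧ lam ∈ Set.Icc (0 : ℝ) 1 ∧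
    U = Submodule.span ℝ (Set.range fun k : Fin m =>
      Real.sqrt lam • EuclideanSpace.single (i k) (1 : ℝ) +
        Real.sqrt (1 - lam) • EuclideanSpace.single (j k) (1 : ℝ))

/-- The family of subspaces `U t` varies continuously: the orthogonal projection onto `U t`
depends continuously on `t`. -/
def IsContinuousFamily {n : ℕ} (U : ℝ → Submodule ℝ (EuclideanSpace ℝ (Fin n))) : Prop :=
  Continuous fun t : ℝ => (U t).starProjection

/-- The operator norm of a square real matrix with respect to the Euclidean norm. -/
noncomputable def euclideanOpNorm {n : ℕ} (A : Matrix (Fin n) (Fin n) ℝ) : ℝ :=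
  ‖Matrix.toEuclideanCLM (𝕜 := ℝ) A‖

/-! The core is restricted invertibility relative to a given set, `exists_lowerRiesz_union`: if the
columns in `S` satisfy a lower Riesz bound with 1/12, some `T` disjoint from `S` with `m` elements
satisfies one with 1/11 by itself and with 1/22 jointly with `S`. This is the barrier method of
Batson, Spielman and Srivastava run with two barriers at once, one for `T` and one for `S ∪ T`. By
`BarrierState.step` each barrier excludes at most 9/20 of the indices, so some index is admissible
for both.

Time is reparametrized so that the operator moves by at most 1/100 per unit of time, and index sets
`F k` are chosen at integer times. The bound 1/11 for `F k` decays to 1/12 at the neighbouring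
integer, which is enough to select the next set; that set starts again at 1/11, so no loss
accumulates along the chain. Between integers the basis vectors of `F k` are rotated into those of
`F (k + 1)`. The subspace stays among vectors supported in `F k ∪ F (k + 1)`, where the joint bound
survives the perturbation. -/

/-! ### Resolvents and lower Riesz bounds. -/

section Barrier

variable {ι E : Type*} [NormedAddCommGroup E] [InnerProductSpace ℝ E]

/-- The vectors `x i`, `i ∈ S`, satisfy the lower Riesz bound with (squared) constant `b`. -/
def LowerRiesz (x : ι → E) (S : Finset ι) (b : ℝ) : Prop :=
  ∀ a : ι → ℝ, b * ∑ i ∈ S, a i ^ 2 ≤ ‖∑ i ∈ S, a i • x i‖ ^ 2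

/-- `R` is a right inverse of `y ↦ ∑ i ∈ S, ⟪x i, y⟫ x i - b y`. -/
def IsResolvent (x : ι → E) (S : Finset ι) (b : ℝ) (R : E →ₗ[ℝ] E) : Prop :=
  ∀ y, ∑ i ∈ S, inner ℝ (x i) (R y) • x i - b • R y = y

/-- The barrier `b` lies below the Gram spectrum of `S` and the barrier potential of `S` at `b`
is at most `-θ`. -/
def BarrierState [Fintype ι] (x : ι → E) (S : Finset ι) (b θ : ℝ) : Prop :=
  LowerRiesz x S b ∧
    ∃ R : E →ₗ[ℝ] E, IsResolvent x S b R ∧ ∑ i, inner ℝ (x i) (R (x i)) ≤ -θ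

variable {x : ι → E} {S : Finset ι} {b c : ℝ} {R : E →ₗ[ℝ] E}

theorem LowerRiesz.mono (h : LowerRiesz x S c) (hbc : b ≤ c) : LowerRiesz x S b := fun a =>
  (mul_le_mul_of_nonneg_right hbc (Finset.sum_nonneg fun _ _ => sq_nonneg _)).trans (h a)

theorem lowerRiesz_empty : LowerRiesz x ∅ c := fun a => by simp

theorem sum_inner_mul_inner (x : ι → E) (S : Finset ι) (a : ι → ℝ) (z : E) :
    inner ℝ (∑ i ∈ S, a i • x i) z = ∑ i ∈ S, a i * inner ℝ (x i) z := by
  simp [sum_inner, real_inner_smul_left]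

/-- For `y` in the kernel, nonzero coefficients `⟪x i, y⟫` would form an eigenvector of the Gram
matrix with eigenvalue `b < c`. They vanish, so `b • y = 0`. -/
theorem LowerRiesz.exists_isResolvent [FiniteDimensional ℝ E] (h : LowerRiesz x S c)
    (hb : 0 < b) (hbc : b < c) : ∃ R : E →ₗ[ℝ] E, IsResolvent x S b R := by
  let T : E →ₗ[ℝ] E :=
    ∑ i ∈ S, ((innerₛₗ ℝ (x i)).smulRight (x i)) - b • LinearMap.id
  have hT : ∀ y, T y = ∑ i ∈ S, inner ℝ (x i) y • x i - b • y := by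
    intro y; simp [T, LinearMap.sum_apply]
  have hinj : Function.Injective T := by
    rw [← LinearMap.ker_eq_bot, LinearMap.ker_eq_bot']
    intro y hy
    rw [hT, sub_eq_zero] at hy
    have h1 := h fun i => inner ℝ (x i) y
    have h2 : ‖∑ i ∈ S, inner ℝ (x i) y • x i‖ ^ 2 = b * ∑ i ∈ S, inner ℝ (x i) y ^ 2 := by
      rw [← real_inner_self_eq_norm_sq]
      nth_rewrite 2 [hy]
      rw [real_inner_smul_right, sum_inner_mul_inner x S (fun i => inner ℝ (x i) y)]
      simp only [sq]
    have h0 : 0 ≤ ∑ i ∈ S, inner ℝ (x i) y ^ 2 := Finset.sum_nonneg fun _ _ => sq_nonneg _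
    have h3 : ∑ i ∈ S, inner ℝ (x i) y ^ 2 = 0 := by nlinarith
    rw [h3, mul_zero, hy] at h2
    have h4 : b • y = 0 := by simpa using h2
    exact (smul_eq_zero.1 h4).resolve_left hb.ne'
  refine ⟨(LinearEquiv.ofInjectiveEndo T hinj).symm.toLinearMap, fun y => ?_⟩
  rw [← hT]
  exact (LinearEquiv.ofInjectiveEndo T hinj).apply_symm_apply y

theorem IsResolvent.inner_comm (hR : IsResolvent x S b R) (y z : E) :
    inner ℝ y (R z) = inner ℝ (R y) z := by
  have h1 : inner ℝ (∑ i ∈ S, inner ℝ (x i) (R y) • x i - b • R y) (R z) = inner ℝ y (R z) := by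
    rw [hR y]
  have h2 : inner ℝ (R y) (∑ i ∈ S, inner ℝ (x i) (R z) • x i - b • R z) = inner ℝ (R y) z := by
    rw [hR z]
  rw [← h1, ← h2, real_inner_comm _ (R y)]
  simp only [inner_sub_left, sum_inner_mul_inner x S (fun i => inner ℝ (x i) _),
    real_inner_smul_left]
  rw [real_inner_comm (R z) (R y)]
  congr 1
  exact Finset.sum_congr rfl fun i _ => mul_comm _ _

/-- Completing the square in `a`: the critical point is `a i = ⟪x i, R y⟫`, with critical value `-b
⟪y, R y⟫`. Under the lower Riesz bound the remaining form is nonnegative. -/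
theorem IsResolvent.quadratic_identity (hR : IsResolvent x S b R) (y : E) (a : ι → ℝ) :
    ‖y - ∑ i ∈ S, a i • x i‖ ^ 2 - b * ∑ i ∈ S, a i ^ 2 =
      -b * inner ℝ y (R y) +
        (‖∑ i ∈ S, (a i - inner ℝ (x i) (R y)) • x i‖ ^ 2 -
          b * ∑ i ∈ S, (a i - inner ℝ (x i) (R y)) ^ 2) := by
  set z := R y with hz
  set w := ∑ i ∈ S, (a i - inner ℝ (x i) z) • x i with hw
  have h1 : y - ∑ i ∈ S, a i • x i = -(b • z + w) := by
    have := hR y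
    rw [← hz] at this
    rw [hw]
    simp only [sub_smul, Finset.sum_sub_distrib]
    nth_rewrite 1 [← this]
    abel
  have h2 : inner ℝ z w = ∑ i ∈ S, (a i - inner ℝ (x i) z) * inner ℝ (x i) z := by
    rw [real_inner_comm, hw, sum_inner_mul_inner x S (fun i => a i - inner ℝ (x i) z)]
  have h3 : inner ℝ y z = ∑ i ∈ S, inner ℝ (x i) z ^ 2 - b * ‖z‖ ^ 2 := by
    have := congrArg (fun u => inner ℝ u z) (hR y)
    simp only [inner_sub_left, real_inner_smul_left, ← hz,
      sum_inner_mul_inner x S (fun i => inner ℝ (x i) z), real_inner_self_eq_norm_sq] at this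
    rw [← this]
    simp only [sq]
  have h4 : ∑ i ∈ S, a i ^ 2 = ∑ i ∈ S, (a i - inner ℝ (x i) z) ^ 2 +
      2 * (∑ i ∈ S, (a i - inner ℝ (x i) z) * inner ℝ (x i) z) + ∑ i ∈ S, inner ℝ (x i) z ^ 2 := by
    rw [Finset.mul_sum, ← Finset.sum_add_distrib, ← Finset.sum_add_distrib]
    exact Finset.sum_congr rfl fun i _ => by ring
  rw [h1, norm_neg, norm_add_sq_real, norm_smul, real_inner_smul_left, h2, h3, h4, mul_pow,
    Real.norm_eq_abs, sq_abs]
  ring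

theorem IsResolvent.neg_le_inner (hR : IsResolvent x S b R) (h : LowerRiesz x S b) (y : E) :
    -‖y‖ ^ 2 ≤ b * inner ℝ y (R y) := by
  have h1 := hR.quadratic_identity y 0
  have h2 := h fun i => (0 : ι → ℝ) i - inner ℝ (x i) (R y)
  simp only [Pi.zero_apply, zero_smul, Finset.sum_const_zero, sub_zero] at h1
  simp only [Pi.zero_apply] at h2
  norm_num at h1 h2
  linarith

/-- The spectral gap `c - b` absorbs the cross term through Young's inequality. Summed over all
indices, this bounds the initial potential. -/
theorem IsResolvent.inner_le (hR : IsResolvent x S b R) (h : LowerRiesz x S c) (hbc : b < c)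
    (y : E) :
    b * inner ℝ y (R y) ≤ -‖y‖ ^ 2 + (∑ i ∈ S, inner ℝ (x i) y ^ 2) / (c - b) := by
  have hcb : 0 < c - b := sub_pos.2 hbc
  set z := R y with hz
  set s := ∑ i ∈ S, inner ℝ (x i) z • x i with hs
  have hsz : s = y + b • z := by
    have := hR y
    rw [← hz, ← hs] at this
    rw [← this]; abel
  have h1 : ‖s‖ ^ 2 = ∑ i ∈ S, inner ℝ (x i) z * inner ℝ (x i) y +
      b * ∑ i ∈ S, inner ℝ (x i) z ^ 2 := by
    rw [← real_inner_self_eq_norm_sq]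
    nth_rewrite 2 [hsz]
    rw [inner_add_right, real_inner_smul_right, hs,
      sum_inner_mul_inner x S (fun i => inner ℝ (x i) z),
      sum_inner_mul_inner x S (fun i => inner ℝ (x i) z)]
    simp only [sq]
  have h2 : b * inner ℝ y z = -‖y‖ ^ 2 + ∑ i ∈ S, inner ℝ (x i) z * inner ℝ (x i) y := by
    have : inner ℝ s y = ∑ i ∈ S, inner ℝ (x i) z * inner ℝ (x i) y := by
      rw [hs, sum_inner_mul_inner x S (fun i => inner ℝ (x i) z)]
    rw [← this, hsz, inner_add_left, real_inner_self_eq_norm_sq, real_inner_smul_left,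
      real_inner_comm y z]
    ring
  have h3 := h fun i => inner ℝ (x i) z
  rw [← hs, h1] at h3
  have h4 : ∑ i ∈ S, inner ℝ (x i) z * inner ℝ (x i) y ≤
      (c - b) / 2 * ∑ i ∈ S, inner ℝ (x i) z ^ 2 +
        1 / 2 * ((∑ i ∈ S, inner ℝ (x i) y ^ 2) / (c - b)) := by
    rw [Finset.mul_sum, Finset.sum_div, Finset.mul_sum, ← Finset.sum_add_distrib]
    refine Finset.sum_le_sum fun i _ => ?_
    have : (c - b) / 2 * inner ℝ (x i) z ^ 2 + 1 / 2 * (inner ℝ (x i) y ^ 2 / (c - b)) -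
        inner ℝ (x i) z * inner ℝ (x i) y =
        ((c - b) * inner ℝ (x i) z - inner ℝ (x i) y) ^ 2 / (2 * (c - b)) := by
      field_simp
      ring
    have h5 : 0 ≤ ((c - b) * inner ℝ (x i) z - inner ℝ (x i) y) ^ 2 / (2 * (c - b)) := by
      positivity
    linarith
  rw [h2]
  nlinarith

theorem IsResolvent.bounded_below (hR : IsResolvent x S b R) (h : LowerRiesz x S b) (y : E)
    (a : ι → ℝ) (s : ℝ) :
    b * s ^ 2 * (-1 - inner ℝ y (R y)) ≤
      ‖s • y + ∑ i ∈ S, a i • x i‖ ^ 2 - b * (s ^ 2 + ∑ i ∈ S, a i ^ 2) := by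
  have h1 := hR.quadratic_identity (s • y) (-a)
  have h2 := h fun i => (-a) i - inner ℝ (x i) (R (s • y))
  simp only [Pi.neg_apply, neg_smul, Finset.sum_neg_distrib, sub_neg_eq_add, neg_sq] at h1
  simp only [Pi.neg_apply] at h2
  have h3 : inner ℝ (s • y) (R (s • y)) = s ^ 2 * inner ℝ y (R y) := by
    rw [map_smul, real_inner_smul_left, real_inner_smul_right]; ring
  rw [h3] at h1
  linarith

theorem IsResolvent.notMem [DecidableEq ι] (hR : IsResolvent x S b R) (h : LowerRiesz x S b)
    (hb : 0 < b) {i : ι} (hi : 0 < -1 - inner ℝ (x i) (R (x i))) : i ∉ S := by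
  intro hiS
  -- For `i ∈ S` this combination is `x i - x i = 0`, so the right side is `-2 * b`.
  have h1 := hR.bounded_below h (x i) (fun j => if j = i then -1 else 0) 1
  simp [hiS, ite_smul, ite_pow] at h1
  nlinarith

theorem IsResolvent.lowerRiesz_insert [DecidableEq ι] (hR : IsResolvent x S b R)
    (h : LowerRiesz x S b) (hb : 0 < b) {i : ι} (hi : 0 < -1 - inner ℝ (x i) (R (x i))) :
    LowerRiesz x (insert i S) b := by
  intro a
  have hiS := hR.notMem h hb hi
  have h1 := hR.bounded_below h (x i) a (a i)
  have h2 : 0 ≤ b * a i ^ 2 * (-1 - inner ℝ (x i) (R (x i))) := by positivity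
  rw [Finset.sum_insert hiS, Finset.sum_insert hiS]
  linarith

/-- The Sherman–Morrison formula. -/
theorem IsResolvent.insert [DecidableEq ι] (hR : IsResolvent x S b R) {i : ι} (hiS : i ∉ S)
    (hi : 0 < -1 - inner ℝ (x i) (R (x i))) :
    IsResolvent x (insert i S) b (R + (-1 - inner ℝ (x i) (R (x i)))⁻¹ •
      (innerₛₗ ℝ (R (x i))).smulRight (R (x i))) := by
  intro y
  set D := -1 - inner ℝ (x i) (R (x i)) with hD
  set s := D⁻¹ * inner ℝ (R (x i)) y with hs
  have hy : (R + D⁻¹ • (innerₛₗ ℝ (R (x i))).smulRight (R (x i))) y = R y + s • R (x i) := by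
    simp [hs, mul_smul]
  have h1 := hR y
  have h2 := hR (x i)
  have h3 : inner ℝ (x i) (R y) = s * D := by
    rw [hR.inner_comm, hs]; field_simp
  have h4 : inner ℝ (x i) (R (x i)) = -1 - D := by rw [hD]; ring
  rw [hy, Finset.sum_insert hiS]
  simp only [inner_add_right, real_inner_smul_right, add_smul, Finset.sum_add_distrib, smul_add,
    mul_smul, ← Finset.smul_sum]
  have h5 : ∑ j ∈ S, inner ℝ (x j) (R y) • x j = y + b • R y := by
    rw [← sub_eq_iff_eq_add]; exact h1
  have h6 : ∑ j ∈ S, inner ℝ (x j) (R (x i)) • x j = x i + b • R (x i) := by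
    rw [← sub_eq_iff_eq_add]; exact h2
  rw [h5, h6, h3, h4]
  module

/-- The resolvent identity `R - R' = (b - b') R R'`, expanded to second order. It gives the
potential gained by lowering the barrier, which pays for adding an index. -/
theorem IsResolvent.shift {b' : ℝ} {R' : E →ₗ[ℝ] E} (hR : IsResolvent x S b R)
    (hR' : IsResolvent x S b' R') (h : LowerRiesz x S b) (hb : 0 < b) (y : E) :
    (b - b') * b' / b * ‖R' y‖ ^ 2 ≤ inner ℝ y (R y) - inner ℝ y (R' y) := by
  set z := R' y with hz
  have h1 : y - (b - b') • z = ∑ i ∈ S, inner ℝ (x i) z • x i - b • z := by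
    have := hR' y
    rw [← hz] at this
    nth_rewrite 1 [← this]
    module
  -- `R` is given only as a right inverse; its symmetry makes it a left inverse.
  have h2 : R (y - (b - b') • z) = z := by
    refine ext_inner_left ℝ fun u => ?_
    rw [hR.inner_comm, h1, inner_sub_right, inner_sum]
    simp only [real_inner_smul_right]
    have h3 := congrArg (fun v => inner ℝ v z) (hR u)
    simp only [inner_sub_left, real_inner_smul_left,
      sum_inner_mul_inner x S (fun i => inner ℝ (x i) (R u))] at h3
    rw [← h3]
    congr 1
    refine Finset.sum_congr rfl fun i _ => ?_
    rw [real_inner_comm (R u) (x i)]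
    ring
  have h3 : R y = z + (b - b') • R z := by
    rw [map_sub, map_smul, sub_eq_iff_eq_add] at h2
    exact h2
  have h4 : inner ℝ y (R y) - inner ℝ y z =
      (b - b') * ‖z‖ ^ 2 + (b - b') ^ 2 * inner ℝ z (R z) := by
    have h5 : inner ℝ y (R z) = ‖z‖ ^ 2 + (b - b') * inner ℝ z (R z) := by
      rw [hR.inner_comm, h3, inner_add_left, real_inner_smul_left, real_inner_self_eq_norm_sq,
        real_inner_comm]
    nth_rewrite 1 [h3]
    rw [inner_add_right, real_inner_smul_right, h5]
    ring
  have h5 := hR.neg_le_inner h z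
  have h6 : -‖z‖ ^ 2 / b ≤ inner ℝ z (R z) := by
    rw [div_le_iff₀ hb]; linarith
  rw [h4]
  have h7 := mul_le_mul_of_nonneg_left h6 (sq_nonneg (b - b'))
  have h8 : (b - b') * b' / b * ‖z‖ ^ 2 =
      (b - b') * ‖z‖ ^ 2 + (b - b') ^ 2 * (-‖z‖ ^ 2 / b) := by
    field_simp
    ring
  linarith

end Barrier

/-! ### Choosing indices by the barrier method. -/

section Selection

variable {ι E : Type*} [NormedAddCommGroup E] [InnerProductSpace ℝ E] [FiniteDimensional ℝ E]
  [Fintype ι] {x : ι → E} {S : Finset ι} {b c : ℝ}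

theorem LowerRiesz.barrierState {B : ℝ} (hx : ∀ i, ‖x i‖ = 1)
    (hB : ∀ y, ∑ j, inner ℝ (x j) y ^ 2 ≤ B * ‖y‖ ^ 2) (h : LowerRiesz x S c)
    (hb : 0 < b) (hbc : b < c) :
    BarrierState x S b (Fintype.card ι / b - S.card * B / (b * (c - b))) := by
  have hcb : 0 < c - b := sub_pos.2 hbc
  obtain ⟨R, hR⟩ := h.exists_isResolvent hb hbc
  refine ⟨h.mono hbc.le, R, hR, ?_⟩
  have h1 : ∑ i, ∑ j ∈ S, inner ℝ (x j) (x i) ^ 2 ≤ S.card * B := by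
    rw [Finset.sum_comm, ← nsmul_eq_mul]
    refine Finset.sum_le_card_nsmul _ _ _ fun j _ => ?_
    have := hB (x j)
    rw [hx, one_pow, mul_one] at this
    refine le_trans (Finset.sum_le_sum fun i _ => ?_) this
    rw [real_inner_comm]
  have h2 : b * ∑ i, inner ℝ (x i) (R (x i)) ≤ -Fintype.card ι + S.card * B / (c - b) := by
    rw [Finset.mul_sum]
    calc ∑ i, b * inner ℝ (x i) (R (x i))
        ≤ ∑ i, (-1 + (∑ j ∈ S, inner ℝ (x j) (x i) ^ 2) / (c - b)) :=
          Finset.sum_le_sum fun i _ => by simpa [hx] using hR.inner_le h hbc (x i)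
      _ = -Fintype.card ι + (∑ i, ∑ j ∈ S, inner ℝ (x j) (x i) ^ 2) / (c - b) := by
          rw [Finset.sum_add_distrib, Finset.sum_div]; simp
      _ ≤ _ := by gcongr
  have h3 : -((Fintype.card ι : ℝ) / b - S.card * B / (b * (c - b))) =
      (-Fintype.card ι + S.card * B / (c - b)) / b := by
    field_simp; ring
  rw [h3, le_div_iff₀ hb]
  linarith

/-- One step of the barrier method: fewer than half of the indices are bad, and any other index
can be added to `S` at the cost of lowering the barrier. -/
theorem BarrierState.step [DecidableEq ι] {B b' θ : ℝ} (hx : ∀ i, ‖x i‖ = 1)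
    (hB : ∀ y, ∑ j, inner ℝ (x j) y ^ 2 ≤ B * ‖y‖ ^ 2) (h : BarrierState x S b θ)
    (hb' : 0 < b') (hbb : b' < b) (hδ : B ≤ Fintype.card ι * ((b - b') * b' / b))
    (h5 : 5 < 1 / b')
    (hθ : Fintype.card ι * (1 / b') - θ ≤ Fintype.card ι / 5 * (1 / b' - 5)) :
    ∃ T : Finset ι, (T.card : ℝ) ≤ 9 / 20 * Fintype.card ι ∧
      ∀ i ∉ T, i ∉ S ∧ BarrierState x (insert i S) b' θ := by
  obtain ⟨hS, R, hR, hΦ⟩ := h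
  have hb : 0 < b := hb'.trans hbb
  obtain ⟨R', hR'⟩ := hS.exists_isResolvent hb' hbb
  have hS' := hS.mono hbb.le
  set n : ℝ := (Fintype.card ι : ℝ) with hn
  have hn0 : 0 ≤ n := Nat.cast_nonneg _
  set V := ∑ j, ‖R' (x j)‖ ^ 2 with hV
  have hV0 : 0 ≤ V := Finset.sum_nonneg fun _ _ => sq_nonneg _
  set κ := (b - b') * b' / b with hκ
  have hκ0 : 0 < κ := div_pos (mul_pos (sub_pos.2 hbb) hb') hb
  have hdrop : ∑ i, inner ℝ (x i) (R' (x i)) + κ * V ≤ -θ := by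
    refine le_trans ?_ hΦ
    rw [hV, Finset.mul_sum, ← Finset.sum_add_distrib]
    refine Finset.sum_le_sum fun i _ => ?_
    have := hR.shift hR' hS hb (x i)
    linarith
  have hκV : 0 ≤ κ * V := mul_nonneg hκ0.le hV0
  set T₁ := Finset.univ.filter fun i => -5 < inner ℝ (x i) (R' (x i)) with hT₁
  set T₂ := Finset.univ.filter fun i => 4 * V < n * ‖R' (x i)‖ ^ 2 with hT₂
  -- Markov's inequality for the nonnegative quantities `1 / b' + ⟪x i, R' (x i)⟫`.
  have hc₁ : (T₁.card : ℝ) ≤ n / 5 := by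
    have h1 : (T₁.card : ℝ) * (1 / b' - 5) ≤ n * (1 / b') - θ := by
      calc (T₁.card : ℝ) * (1 / b' - 5) = ∑ i ∈ T₁, (1 / b' - 5) := by
            rw [Finset.sum_const, nsmul_eq_mul]
        _ ≤ ∑ i ∈ T₁, (1 / b' + inner ℝ (x i) (R' (x i))) := by
            refine Finset.sum_le_sum fun i hi => ?_
            have := (Finset.mem_filter.1 hi).2
            linarith
        _ ≤ ∑ i, (1 / b' + inner ℝ (x i) (R' (x i))) := by
            refine Finset.sum_le_sum_of_subset_of_nonneg (Finset.subset_univ _) fun i _ _ => ?_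
            have := hR'.neg_le_inner hS' (x i)
            rw [hx, one_pow] at this
            have h2 : -1 / b' ≤ inner ℝ (x i) (R' (x i)) := by
              rw [div_le_iff₀ hb']; linarith
            rw [neg_div] at h2
            linarith
        _ = n * (1 / b') + ∑ i, inner ℝ (x i) (R' (x i)) := by
            rw [Finset.sum_add_distrib]; simp [hn]
        _ ≤ n * (1 / b') - θ := by linarith
    exact le_of_mul_le_mul_right (h1.trans hθ) (sub_pos.2 h5)
  have hc₂ : (T₂.card : ℝ) ≤ n / 4 := by
    have h1 : (T₂.card : ℝ) * (4 * V) ≤ n * V := by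
      calc (T₂.card : ℝ) * (4 * V) = ∑ i ∈ T₂, 4 * V := by simp
        _ ≤ ∑ i ∈ T₂, n * ‖R' (x i)‖ ^ 2 :=
            Finset.sum_le_sum fun i hi => (Finset.mem_filter.1 hi).2.le
        _ ≤ ∑ i, n * ‖R' (x i)‖ ^ 2 :=
            Finset.sum_le_sum_of_subset_of_nonneg (Finset.subset_univ _) fun i _ _ => by positivity
        _ = n * V := by rw [hV, Finset.mul_sum]
    rcases hV0.eq_or_lt with hV1 | hV1
    · have : T₂ = ∅ := by
        refine Finset.filter_eq_empty_iff.2 fun i _ => ?_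
        have h2 : ‖R' (x i)‖ ^ 2 ≤ V :=
          Finset.single_le_sum (f := fun j => ‖R' (x j)‖ ^ 2) (fun j _ => sq_nonneg _)
            (Finset.mem_univ i)
        rw [← hV1] at h2 ⊢
        nlinarith
      rw [this, Finset.card_empty, Nat.cast_zero]
      positivity
    · nlinarith
  refine ⟨T₁ ∪ T₂, ?_, fun i hi => ?_⟩
  · have : ((T₁ ∪ T₂).card : ℝ) ≤ T₁.card + T₂.card := by exact_mod_cast Finset.card_union_le _ _
    linarith
  · rw [Finset.mem_union, not_or] at hi
    have hi₁ : inner ℝ (x i) (R' (x i)) ≤ -5 := by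
      by_contra! hh; exact hi.1 (Finset.mem_filter.2 ⟨Finset.mem_univ _, hh⟩)
    have hi₂ : n * ‖R' (x i)‖ ^ 2 ≤ 4 * V := by
      by_contra! hh; exact hi.2 (Finset.mem_filter.2 ⟨Finset.mem_univ _, hh⟩)
    set D := -1 - inner ℝ (x i) (R' (x i)) with hD
    have hD4 : 4 ≤ D := by rw [hD]; linarith
    have hD0 : 0 < D := by linarith
    have hiS := hR'.notMem hS' hb' hD0
    refine ⟨hiS, hR'.lowerRiesz_insert hS' hb' hD0, _, hR'.insert hiS hD0, ?_⟩
    have h1 : ∑ j, inner ℝ (x j)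
        ((R' + D⁻¹ • (innerₛₗ ℝ (R' (x i))).smulRight (R' (x i))) (x j)) =
        ∑ j, inner ℝ (x j) (R' (x j)) + D⁻¹ * ∑ j, inner ℝ (x j) (R' (x i)) ^ 2 := by
      rw [Finset.mul_sum, ← Finset.sum_add_distrib]
      refine Finset.sum_congr rfl fun j _ => ?_
      simp only [LinearMap.add_apply, LinearMap.smul_apply, LinearMap.smulRight_apply,
        innerₛₗ_apply_apply, inner_add_right, real_inner_smul_right]
      rw [real_inner_comm (x j) (R' (x i))]
      ring
    rw [← hD, h1]
    -- The Sherman–Morrison increase is at most the drop `κ * V`: the factor 4 from `T₂` cancels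
    -- against `D ≥ 4` from `T₁`.
    have h2 : D⁻¹ * ∑ j, inner ℝ (x j) (R' (x i)) ^ 2 ≤ κ * V := by
      rw [inv_mul_le_iff₀ hD0]
      calc ∑ j, inner ℝ (x j) (R' (x i)) ^ 2 ≤ B * ‖R' (x i)‖ ^ 2 := hB _
        _ ≤ n * κ * ‖R' (x i)‖ ^ 2 := by gcongr
        _ = κ * (n * ‖R' (x i)‖ ^ 2) := by ring
        _ ≤ κ * (4 * V) := by gcongr
        _ = 4 * (κ * V) := by ring
        _ ≤ D * (κ * V) := by gcongr
    linarith

/-- Restricted invertibility relative to a given well-invertible set `S`: there is a set `T` of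
prescribed size which is well-invertible by itself, and jointly with `S`. -/
theorem exists_lowerRiesz_union [DecidableEq ι] {B : ℝ} {m : ℕ} (hx : ∀ i, ‖x i‖ = 1)
    (hB : ∀ y, ∑ j, inner ℝ (x j) y ^ 2 ≤ B * ‖y‖ ^ 2) (hB0 : 0 < B)
    (hm : 600 * m * B ≤ Fintype.card ι) (hm0 : m ≠ 0) (hSm : S.card ≤ m)
    (hS : LowerRiesz x S (1 / 12)) :
    ∃ T : Finset ι, T.card = m ∧ Disjoint S T ∧ LowerRiesz x T (1 / 11) ∧
      LowerRiesz x (S ∪ T) (1 / 22) := by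
  set n : ℝ := (Fintype.card ι : ℝ) with hn
  have hm1 : (1 : ℝ) ≤ m := by exact_mod_cast Nat.one_le_iff_ne_zero.2 hm0
  have hn0 : 0 < n := by nlinarith
  -- A step needs `B ≤ n * δ * (b' / b)`, and `b' / b ≥ 10 / 11` throughout. The total descent is at
  -- most 1/220 = 1/20 - 1/22.
  set δ : ℝ := 11 / 10 * B / n with hδ
  have hδ0 : 0 < δ := by positivity
  have hδn : n * δ = 11 / 10 * B := by rw [hδ]; field_simp
  have hδm : m * δ ≤ 1 / 220 := by
    rw [hδ, mul_div_assoc', div_le_iff₀ hn0]; linarith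
  have key : ∀ k : ℕ, k ≤ m → ∃ T : Finset ι, T.card = k ∧ Disjoint S T ∧
      BarrierState x T (1 / 10 - k * δ) (10 * n) ∧
      BarrierState x (S ∪ T) (1 / 20 - k * δ) (19 * n) := by
    intro k
    induction k with
    | zero =>
      intro _
      refine ⟨∅, rfl, Finset.disjoint_empty_right _, ?_, ?_⟩
      · have := (lowerRiesz_empty (x := x) (c := 1)).barrierState hx hB
          (b := 1 / 10) (by norm_num) (by norm_num)
        obtain ⟨h1, R, h2, h3⟩ := this
        refine ⟨by simpa using h1, R, by simpa using h2, h3.trans ?_⟩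
        rw [← hn]; simp; linarith
      · have := hS.barrierState hx hB (b := 1 / 20) (by norm_num) (by norm_num)
        obtain ⟨h1, R, h2, h3⟩ := this
        refine ⟨by simpa using h1, R, by simpa using h2, h3.trans ?_⟩
        rw [← hn]
        -- Since (1/20)(1/12 - 1/20) = 1/600, the correction to `20 * n` is `600 * S.card * B ≤ n`;
        -- this is the source of 600 in `hm`.
        have h4 : (S.card : ℝ) ≤ m := by exact_mod_cast hSm
        have h5 : (S.card : ℝ) * B ≤ m * B := by gcongr
        norm_num
        linarith
    | succ k ih =>
      intro hk
      obtain ⟨T, hT, hST, h1, h2⟩ := ih (by omega)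
      have hkm : ((k : ℝ) + 1) * δ ≤ 1 / 220 := by
        refine le_trans ?_ hδm
        gcongr
        exact_mod_cast hk
      have hkδ : 0 ≤ k * δ := by positivity
      have hsucc : ((k + 1 : ℕ) : ℝ) * δ = k * δ + δ := by push_cast; ring
      have one : ∀ {b θ : ℝ} {W : Finset ι}, BarrierState x W b θ → 1 / 22 + δ ≤ b →
          1 / (b - δ) ≤ 22 → 10 ≤ 1 / (b - δ) → n * (1 / (b - δ)) - θ ≤ n / 5 * (1 / (b - δ) - 5) →
          10 / 11 * b ≤ b - δ →
          ∃ T : Finset ι, (T.card : ℝ) ≤ 9 / 20 * Fintype.card ι ∧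
            ∀ i ∉ T, i ∉ W ∧ BarrierState x (insert i W) (b - δ) θ := by
        intro b θ W hW hb hb1 hb2 hb3 hb4
        have hb0 : 0 < b := by linarith
        refine hW.step hx hB (by linarith) (by linarith) ?_ (by linarith) hb3
        rw [← hn, sub_sub_cancel]
        have : δ * (10 / 11) ≤ δ * (b - δ) / b := by
          rw [le_div_iff₀ hb0]; nlinarith
        nlinarith
      rw [hsucc]
      have hle1 : 1 / (1 / 10 - k * δ - δ) ≤ 11 := by
        rw [div_le_iff₀ (by linarith)]; linarith
      have hle2 : 1 / (1 / 20 - k * δ - δ) ≤ 22 := by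
        rw [div_le_iff₀ (by linarith)]; linarith
      have hge1 : 10 ≤ 1 / (1 / 10 - k * δ - δ) := by
        rw [le_div_iff₀ (by linarith)]; linarith
      have hge2 : 20 ≤ 1 / (1 / 20 - k * δ - δ) := by
        rw [le_div_iff₀ (by linarith)]; linarith
      -- The counting condition amounts to `1 / b' ≤ 45 / 4` for `θ = 10 * n` and `1 / b' ≤ 45 / 2`
      -- for `θ = 19 * n`; the barriers keep `1 / b'` below 11 and 22.
      obtain ⟨T₁, hT₁, hT₁'⟩ := one h1 (by linarith) (by linarith) hge1 (by nlinarith)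
        (by linarith)
      obtain ⟨T₂, hT₂, hT₂'⟩ := one h2 (by linarith) hle2 (by linarith) (by nlinarith)
        (by linarith)
      obtain ⟨i, hi⟩ : ∃ i, i ∉ T₁ ∪ T₂ := by
        by_contra! hh
        have h3 : T₁ ∪ T₂ = Finset.univ := Finset.eq_univ_iff_forall.2 hh
        have h4 : ((T₁ ∪ T₂).card : ℝ) ≤ T₁.card + T₂.card := by
          exact_mod_cast Finset.card_union_le _ _
        rw [h3, Finset.card_univ] at h4
        linarith
      rw [Finset.mem_union, not_or] at hi
      obtain ⟨hiT, hs1⟩ := hT₁' i hi.1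
      obtain ⟨hiST, hs2⟩ := hT₂' i hi.2
      rw [Finset.mem_union, not_or] at hiST
      refine ⟨insert i T, by rw [Finset.card_insert_of_notMem hiT, hT], ?_, ?_, ?_⟩
      · exact Finset.disjoint_insert_right.2 ⟨hiST.1, hST⟩
      · rwa [← sub_sub]
      · rwa [← sub_sub, Finset.union_insert]
  obtain ⟨T, hT, hST, h1, h2⟩ := key m le_rfl
  exact ⟨T, hT, hST, h1.1.mono (by linarith), h2.1.mono (by linarith)⟩

end Selection

/-! ### Reparametrizing time and gluing over integer intervals. -/

open Set Filter Topology in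
/-- Time can be reparametrized so that a continuous curve varies by at most `ε` over unit
intervals of the new time. -/
theorem exists_reparametrization {X : Type*} [PseudoMetricSpace X] {f : ℝ → X}
    (hf : Continuous f) {ε : ℝ} (hε : 0 < ε) :
    ∃ h : ℝ → ℝ, Continuous h ∧ Function.Surjective h ∧
      ∀ t t', |h t - h t'| ≤ 1 → dist (f t) (f t') ≤ ε := by
  -- `g` is the speed of the new time. Admissible speeds at `y` form an up-closed, hence convex,
  -- set, so locally constant choices can be glued by a partition of unity.
  obtain ⟨g, hg⟩ := exists_continuous_forall_mem_convex_of_local_const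
    (t := fun y : ℝ => {c : ℝ | 1 ≤ c ∧ ∀ z ∈ Icc (-|y| - 1) (|y| + 1),
      ∀ w ∈ Icc (-|y| - 1) (|y| + 1), c * |z - w| ≤ 1 → dist (f z) (f w) ≤ ε})
    (fun y => by
      refine OrdConnected.convex ⟨fun a ha b _ c hc => ⟨ha.1.trans hc.1, fun z hz w hw hzw => ?_⟩⟩
      exact ha.2 z hz w hw ((mul_le_mul_of_nonneg_right hc.1 (abs_nonneg _)).trans hzw))
    (fun y => by
      have huc := isCompact_Icc.uniformContinuousOn_of_continuous
        (hf.continuousOn (s := Icc (-|y| - 2) (|y| + 2)))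
      obtain ⟨δ, hδ, hδ'⟩ := Metric.uniformContinuousOn_iff.1 huc ε hε
      refine ⟨max 1 (2 / δ), ?_⟩
      have hy : ∀ᶠ z in 𝓝 y, |z| < |y| + 1 :=
        continuous_abs.continuousAt.eventually (gt_mem_nhds (lt_add_one _))
      filter_upwards [hy] with u hu
      refine ⟨le_max_left _ _, fun z hz w hw hzw => ?_⟩
      refine (hδ' z ⟨?_, ?_⟩ w ⟨?_, ?_⟩ ?_).le
      any_goals linarith [hz.1, hz.2, hw.1, hw.2]
      have h1 := (mul_le_mul_of_nonneg_right (le_max_right 1 (2 / δ)) (abs_nonneg (z - w))).trans hzw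
      rw [Real.dist_eq]
      rw [div_mul_eq_mul_div, div_le_iff₀ hδ] at h1
      linarith)
  have hint : ∀ a b, IntervalIntegrable g MeasureTheory.volume a b :=
    fun a b => g.continuous.intervalIntegrable a b
  have hdiff : ∀ t t', (∫ s in (0 : ℝ)..t', g s) - ∫ s in (0 : ℝ)..t, g s = ∫ s in t..t', g s :=
    fun t t' => intervalIntegral.integral_interval_sub_left (hint _ _) (hint _ _)
  have hlow : ∀ t t', t ≤ t' → ∀ c, (∀ s ∈ Icc t t', c ≤ g s) →
      c * (t' - t) ≤ ∫ s in t..t', g s := fun t t' htt c hc => by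
    have := intervalIntegral.integral_mono_on htt (intervalIntegrable_const (c := c)) (hint t t') hc
    rw [intervalIntegral.integral_const, smul_eq_mul] at this
    linarith
  have hcont : Continuous fun t => ∫ s in (0 : ℝ)..t, g s :=
    intervalIntegral.continuous_primitive hint 0
  refine ⟨fun t => ∫ s in (0 : ℝ)..t, g s, hcont, ?_, ?_⟩
  · refine hcont.surjective ?_ ?_
    · refine tendsto_atTop_mono' _ ?_ tendsto_id
      filter_upwards [eventually_ge_atTop 0] with t ht
      have := hlow 0 t ht 1 fun s _ => (hg s).1
      simpa using this
    · refine tendsto_atBot_mono' _ ?_ tendsto_id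
      filter_upwards [eventually_le_atBot 0] with t ht
      have := hlow t 0 ht 1 fun s _ => (hg s).1
      rw [intervalIntegral.integral_symm]
      simp at this ⊢
      linarith
  · have main : ∀ t t', t ≤ t' → |(∫ s in (0 : ℝ)..t, g s) - ∫ s in (0 : ℝ)..t', g s| ≤ 1 →
        dist (f t) (f t') ≤ ε := by
      intro t t' htt h1
      rw [abs_sub_comm, hdiff] at h1
      -- At the slowest point `s`, `g s * (t' - t) ≤ 1`. As `g s ≥ 1`, both ends lie within 1 of
      -- `s`, inside its window.
      obtain ⟨s, hs, hsmin⟩ := isCompact_Icc.exists_isMinOn (nonempty_Icc.2 htt)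
        g.continuous.continuousOn
      have h2 := (hlow t t' htt (g s) fun u hu => hsmin hu).trans ((le_abs_self _).trans h1)
      have h3 := (hg s).1
      have h4 : t' - t ≤ 1 := by nlinarith
      have := neg_abs_le s
      have := le_abs_self s
      refine (hg s).2 t ⟨?_, ?_⟩ t' ⟨?_, ?_⟩ ?_
      any_goals linarith [hs.1, hs.2]
      rwa [abs_sub_comm, abs_of_nonneg (sub_nonneg.2 htt)]
    intro t t' h1
    rcases le_total t t' with htt | htt
    · exact main t t' htt h1
    · rw [dist_comm]
      exact main t' t htt (by rwa [abs_sub_comm])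

/-- Dependent choice in both directions from 0, since the time line has no starting point. -/
theorem exists_int_chain {α : Type*} {P : ℤ → α → Prop} {Q : ℤ → α → α → Prop}
    (h0 : ∃ a, P 0 a) (fwd : ∀ k a, P k a → ∃ b, P (k + 1) b ∧ Q k a b)
    (bwd : ∀ k b, P (k + 1) b → ∃ a, P k a ∧ Q k a b) :
    ∃ f : ℤ → α, ∀ k, P k (f k) ∧ Q k (f k) (f (k + 1)) := by
  obtain ⟨a₀, ha₀⟩ := h0
  choose F hF using fwd
  choose G hG using bwd
  have hcast : ∀ j : ℕ, (-(j + 1 : ℕ) : ℤ) + 1 = -j := fun j => by push_cast; ring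
  let u : ∀ j : ℕ, {a // P j a} := fun j => Nat.rec ⟨a₀, ha₀⟩
    (fun j a => ⟨F j a.1 a.2, (hF j a.1 a.2).1⟩) j
  let v : ∀ j : ℕ, {a // P (-j) a} := fun j => Nat.rec ⟨a₀, ha₀⟩
    (fun j a => ⟨G (-(j + 1 : ℕ)) a.1 ((hcast j).symm ▸ a.2), (hG _ a.1 _).1⟩) j
  have hu : ∀ j : ℕ, Q j (u j).1 (u (j + 1)).1 := fun j => (hF j (u j).1 (u j).2).2
  have hv : ∀ j : ℕ, Q (-(j + 1 : ℕ)) (v (j + 1)).1 (v j).1 := fun j => (hG _ (v j).1 _).2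
  let f : ℤ → α := fun k => if 0 ≤ k then (u k.toNat).1 else (v (-k).toNat).1
  have hfu : ∀ j : ℕ, f j = (u j).1 := fun j => by simp [f]
  have hfv : ∀ j : ℕ, f (-j) = (v j).1 := fun j => by
    rcases j with _ | j
    · simp [f, u, v]
    · have : ¬ (0 : ℤ) ≤ -(j + 1 : ℕ) := by omega
      simp only [f, if_neg this]
      exact congrArg (fun i => (v i).1) (by omega)
  refine ⟨f, fun k => ?_⟩
  rcases le_or_gt 0 k with hk | hk
  · obtain ⟨j, rfl⟩ := Int.eq_ofNat_of_zero_le hk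
    have : ((j : ℤ) + 1) = ((j + 1 : ℕ) : ℤ) := by push_cast; rfl
    rw [this, hfu, hfu]
    exact ⟨(u j).2, hu j⟩
  · obtain ⟨j, rfl⟩ : ∃ j : ℕ, k = -(j + 1 : ℕ) := ⟨(-k - 1).toNat, by omega⟩
    rw [hcast, hfv, hfv]
    exact ⟨(v (j + 1)).2, hv j⟩

open Set Filter Topology in
theorem continuous_of_continuousOn_Icc_int {X : Type*} [TopologicalSpace X] {g : ℝ → X}
    (hg : ∀ k : ℤ, ContinuousOn g (Icc (k : ℝ) (k + 1))) : Continuous g := by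
  refine LocallyFinite.continuous (f := fun k : ℤ => Icc (k : ℝ) (k + 1)) ?_ ?_
    (fun _ => isClosed_Icc) hg
  · intro s
    refine ⟨Ioo (s - 1) (s + 1), Ioo_mem_nhds (by linarith) (by linarith), ?_⟩
    refine (finite_Icc (⌊s⌋ - 2) (⌊s⌋ + 2)).subset ?_
    rintro k ⟨u, hu, hu'⟩
    have h1 := Int.floor_le s
    have h2 := Int.lt_floor_add_one s
    simp only [mem_Icc, mem_Ioo] at hu hu'
    constructor
    · have : ((⌊s⌋ - 2 : ℤ) : ℝ) ≤ k := by push_cast; linarith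
      exact_mod_cast this
    · have : (k : ℝ) < ((⌊s⌋ + 2 : ℤ) : ℝ) := by push_cast; linarith
      exact_mod_cast this.le
  · refine eq_univ_of_forall fun s => mem_iUnion.2 ⟨⌊s⌋, Int.floor_le s, (Int.lt_floor_add_one s).le⟩

theorem Orthonormal.starProjection_span {E ι : Type*} [NormedAddCommGroup E]
    [InnerProductSpace ℝ E] [FiniteDimensional ℝ E] [Fintype ι] {w : ι → E}
    (hw : Orthonormal ℝ w) :
    (Submodule.span ℝ (Set.range w)).starProjection =
      ∑ j, InnerProductSpace.rankOne ℝ (w j) (w j) := by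
  ext y
  have h1 : (∑ j, InnerProductSpace.rankOne ℝ (w j) (w j)) y = ∑ j, inner ℝ (w j) y • w j := by
    simp
  rw [h1]
  refine Submodule.eq_starProjection_of_mem_of_inner_eq_zero
    (Submodule.sum_mem _ fun j _ => Submodule.smul_mem _ _ (Submodule.subset_span ⟨j, rfl⟩)) ?_
  intro u hu
  induction hu using Submodule.span_induction with
  | mem u hu =>
    obtain ⟨j, rfl⟩ := hu
    rw [inner_sub_left, real_inner_comm, real_inner_comm (w j) (∑ _, _), hw.inner_right_fintype,
      sub_self]
  | zero => exact inner_zero_right _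
  | add u v _ _ hu hv => rw [inner_add_right, hu, hv, add_zero]
  | smul a u _ hu => rw [inner_smul_right, hu, mul_zero]

theorem Orthonormal.continuous_starProjection_span {X E ι : Type*} [TopologicalSpace X]
    [NormedAddCommGroup E] [InnerProductSpace ℝ E] [FiniteDimensional ℝ E] [Fintype ι]
    {w : X → ι → E} (hw : ∀ t, Orthonormal ℝ (w t)) (hc : ∀ j, Continuous fun t => w t j) :
    Continuous fun t => (Submodule.span ℝ (Set.range (w t))).starProjection := by
  simp_rw [fun t => (hw t).starProjection_span]
  refine continuous_finsetSum _ fun j _ => ?_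
  exact ((InnerProductSpace.rankOne ℝ).continuous.comp (hc j)).clm_apply (hc j)

/-! ### Perturbation bounds and interpolating frames in Euclidean space. -/

section Euclidean

variable {n : ℕ}

theorem EuclideanSpace.sum_smul_single (v : EuclideanSpace ℝ (Fin n)) :
    ∑ i, v i • EuclideanSpace.single i (1 : ℝ) = v := by
  simpa using (EuclideanSpace.basisFun (Fin n) ℝ).sum_repr v

theorem lowerRiesz_single_iff
    {T : EuclideanSpace ℝ (Fin n) →L[ℝ] EuclideanSpace ℝ (Fin n)} {S : Finset (Fin n)} {b : ℝ} :
    LowerRiesz (fun i => T (EuclideanSpace.single i 1)) S b ↔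
      ∀ v : EuclideanSpace ℝ (Fin n), (∀ i ∉ S, v i = 0) → b * ‖v‖ ^ 2 ≤ ‖T v‖ ^ 2 := by
  have key : ∀ v : EuclideanSpace ℝ (Fin n), (∀ i ∉ S, v i = 0) →
      T v = ∑ i ∈ S, v i • T (EuclideanSpace.single i 1) ∧ ‖v‖ ^ 2 = ∑ i ∈ S, v i ^ 2 := by
    intro v hv
    constructor
    · conv_lhs => rw [← EuclideanSpace.sum_smul_single v]
      rw [map_sum]
      simp only [map_smul]
      refine (Finset.sum_subset (Finset.subset_univ S) fun i _ hi => ?_).symm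
      rw [hv i hi, zero_smul]
    · rw [EuclideanSpace.real_norm_sq_eq]
      refine (Finset.sum_subset (Finset.subset_univ S) fun i _ hi => ?_).symm
      rw [hv i hi]; norm_num
  constructor
  · intro h v hv
    rw [(key v hv).1, (key v hv).2]
    exact h fun i => v i
  · intro h a
    classical
    have h1 := key (WithLp.toLp 2 fun i => if i ∈ S then a i else 0) (fun i hi => by simp [hi])
    have h2 := h (WithLp.toLp 2 fun i => if i ∈ S then a i else 0) (fun i hi => by simp [hi])
    rw [h1.1, h1.2] at h2
    refine le_trans (le_of_eq ?_) (h2.trans (le_of_eq ?_))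
    · congr 1
      exact Finset.sum_congr rfl fun i hi => by simp [hi]
    · congr 2
      exact Finset.sum_congr rfl fun i hi => by simp [hi]

theorem LowerRiesz.norm_le_of_dist_le
    {T T' : EuclideanSpace ℝ (Fin n) →L[ℝ] EuclideanSpace ℝ (Fin n)} {S : Finset (Fin n)}
    {b r ε : ℝ} (h : LowerRiesz (fun i => T (EuclideanSpace.single i 1)) S b)
    (hT : dist T T' ≤ ε) (hrb : r ^ 2 ≤ b)
    {v : EuclideanSpace ℝ (Fin n)} (hv : ∀ i ∉ S, v i = 0) : (r - ε) * ‖v‖ ≤ ‖T' v‖ := by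
  have h1 := lowerRiesz_single_iff.1 h v hv
  have h2 : r * ‖v‖ ≤ ‖T v‖ := by
    refine le_of_sq_le_sq ?_ (norm_nonneg _)
    rw [mul_pow]
    exact (mul_le_mul_of_nonneg_right hrb (sq_nonneg _)).trans h1
  have h3 : ‖T v‖ - ‖T' v‖ ≤ ε * ‖v‖ := by
    refine (norm_sub_norm_le _ _).trans ?_
    rw [← sub_apply]
    refine ((T - T').le_opNorm v).trans ?_
    rw [dist_eq_norm] at hT
    gcongr
  linarith

theorem LowerRiesz.of_dist_le
    {T T' : EuclideanSpace ℝ (Fin n) →L[ℝ] EuclideanSpace ℝ (Fin n)} {S : Finset (Fin n)}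
    {b c r ε : ℝ} (h : LowerRiesz (fun i => T (EuclideanSpace.single i 1)) S b)
    (hT : dist T T' ≤ ε) (hrb : r ^ 2 ≤ b) (hrε : ε ≤ r) (hc : c ≤ (r - ε) ^ 2) :
    LowerRiesz (fun i => T' (EuclideanSpace.single i 1)) S c := by
  refine lowerRiesz_single_iff.2 fun v hv => ?_
  have h1 := h.norm_le_of_dist_le hT hrb hv
  refine (mul_le_mul_of_nonneg_right hc (sq_nonneg _)).trans ?_
  rw [← mul_pow]
  exact pow_le_pow_left₀ (mul_nonneg (sub_nonneg.2 hrε) (norm_nonneg _)) h1 2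

/-- The sum is `‖T* y‖ ^ 2`, and the adjoint has the same norm. This supplies `B = L ^ 2` in the
selection. -/
theorem sum_inner_single_sq_le
    (T : EuclideanSpace ℝ (Fin n) →L[ℝ] EuclideanSpace ℝ (Fin n)) {L : ℝ} (hL : ‖T‖ ≤ L)
    (y : EuclideanSpace ℝ (Fin n)) :
    ∑ j, inner ℝ (T (EuclideanSpace.single j 1)) y ^ 2 ≤ L ^ 2 * ‖y‖ ^ 2 := by
  have h1 : ∀ j, inner ℝ (T (EuclideanSpace.single j 1)) y =
      (ContinuousLinearMap.adjoint T y) j := fun j => by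
    rw [← ContinuousLinearMap.adjoint_inner_right]
    simp [EuclideanSpace.inner_single_left]
  simp only [h1]
  rw [← EuclideanSpace.real_norm_sq_eq, ← mul_pow]
  refine pow_le_pow_left₀ (norm_nonneg _) ?_ 2
  refine (ContinuousLinearMap.le_opNorm _ _).trans ?_
  rw [LinearIsometryEquiv.norm_map]
  gcongr

theorem orthonormal_combination {m : ℕ} {i j : Fin m → Fin n} (hi : Function.Injective i)
    (hj : Function.Injective j) (hij : ∀ k l, i k ≠ j l) {α β : ℝ} (hαβ : α ^ 2 + β ^ 2 = 1) :
    Orthonormal ℝ fun k : Fin m =>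
      α • EuclideanSpace.single (i k) (1 : ℝ) + β • EuclideanSpace.single (j k) (1 : ℝ) := by
  rw [orthonormal_iff_ite]
  intro k l
  simp only [inner_add_left, inner_add_right, real_inner_smul_left, real_inner_smul_right,
    EuclideanSpace.inner_single_left, PiLp.single_apply, hi.eq_iff, hj.eq_iff]
  simp only [hij, (hij _ _).symm, map_one, one_mul, if_false, mul_zero, add_zero, zero_add]
  split_ifs
  · linarith
  · ring

/-- The vectors interpolating between the basis vectors listed by `f ⌊s⌋` and `f (⌊s⌋ + 1)`. -/
noncomputable def interpolation {m : ℕ} (f : ℤ → Fin m → Fin n) (s : ℝ) (k : Fin m) :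
    EuclideanSpace ℝ (Fin n) :=
  √(1 - Int.fract s) • EuclideanSpace.single (f ⌊s⌋ k) (1 : ℝ) +
    √(1 - (1 - Int.fract s)) • EuclideanSpace.single (f (⌊s⌋ + 1) k) (1 : ℝ)

theorem continuous_interpolation {m : ℕ} (f : ℤ → Fin m → Fin n) (k : Fin m) :
    Continuous fun s => interpolation f s k := by
  refine continuous_of_continuousOn_Icc_int fun l => ?_
  have hc : Continuous fun s : ℝ => √(1 - (s - l)) • EuclideanSpace.single (f l k) (1 : ℝ) +
      √(1 - (1 - (s - l))) • EuclideanSpace.single (f (l + 1) k) (1 : ℝ) := by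
    fun_prop
  refine hc.continuousOn.congr fun s hs => ?_
  -- At the right end the floor jumps, but both formulas reduce to the basis vector of index `f (l +
  -- 1) k`.
  rcases hs.2.eq_or_lt with h | h
  · have hs' : s = ((l + 1 : ℤ) : ℝ) := by rw [h]; push_cast; rfl
    have h1 : s - l = 1 := by rw [h]; ring
    have h2 : Int.fract s = 0 := by rw [hs', Int.fract_intCast]
    have h3 : ⌊s⌋ = l + 1 := by rw [hs', Int.floor_intCast]
    simp only [interpolation, h1, h2, h3]
    simp
  · have h3 : ⌊s⌋ = l := Int.floor_eq_iff.2 ⟨hs.1, h⟩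
    simp only [interpolation, Int.fract, h3]

end Euclidean

/-! ### Assembling the family and choosing its dimension. -/

open Set in
/-- The theorem for operator-valued curves, for a given size `m` of the subspaces. -/
theorem exists_continuous_family {n m : ℕ} (hm0 : m ≠ 0)
    {T : ℝ → EuclideanSpace ℝ (Fin n) →L[ℝ] EuclideanSpace ℝ (Fin n)} (hT : Continuous T)
    (hcol : ∀ t i, ‖T t (EuclideanSpace.single i 1)‖ = 1) {L : ℝ} (hL0 : 0 < L)
    (hL : ∀ t, ‖T t‖ ≤ L) (hm : 600 * m * L ^ 2 ≤ n) :
    ∃ U : ℝ → Submodule ℝ (EuclideanSpace ℝ (Fin n)),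
      (∀ t, Module.finrank ℝ (U t) = m) ∧ IsContinuousFamily U ∧
      (∀ t, ∀ v ∈ U t, 1 / 33 * ‖v‖ ≤ ‖T t v‖) ∧
      ∀ t, IsQuadraticConvexCombination m (U t) := by
  obtain ⟨h, hh, hsurj, hdist⟩ := exists_reparametrization hT (ε := 1 / 100) (by norm_num)
  choose τ hτ using fun k : ℤ => hsurj k
  have hsel : ∀ (k : ℤ) (S : Finset (Fin n)), S.card ≤ m →
      LowerRiesz (fun i => T (τ k) (EuclideanSpace.single i 1)) S (1 / 12) →
      ∃ S' : Finset (Fin n), S'.card = m ∧ Disjoint S S' ∧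
        LowerRiesz (fun i => T (τ k) (EuclideanSpace.single i 1)) S' (1 / 11) ∧
        LowerRiesz (fun i => T (τ k) (EuclideanSpace.single i 1)) (S ∪ S') (1 / 22) :=
    fun k S hS h1 => exists_lowerRiesz_union (hcol (τ k)) (sum_inner_single_sq_le _ (hL _))
      (by positivity) (by simpa using hm) hm0 hS h1
  -- 0.301² ≤ 1/11 and 1/12 ≤ (0.301 - 0.01)².
  have htrans : ∀ {t t' : ℝ} {S : Finset (Fin n)}, |h t - h t'| ≤ 1 →
      LowerRiesz (fun i => T t (EuclideanSpace.single i 1)) S (1 / 11) →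
      LowerRiesz (fun i => T t' (EuclideanSpace.single i 1)) S (1 / 12) := fun htt h1 =>
    h1.of_dist_le (r := 301 / 1000) (hdist _ _ htt) (by norm_num) (by norm_num) (by norm_num)
  have hjoint : ∀ {t t' : ℝ} {S : Finset (Fin n)}, |h t - h t'| ≤ 1 →
      LowerRiesz (fun i => T t (EuclideanSpace.single i 1)) S (1 / 22) →
      ∀ v : EuclideanSpace ℝ (Fin n), (∀ i ∉ S, v i = 0) → 1 / 33 * ‖v‖ ≤ ‖T t' v‖ :=
    fun htt h1 v hv => by
      have h2 := h1.norm_le_of_dist_le (r := 1 / 5) (hdist _ _ htt) (by norm_num) hv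
      have := norm_nonneg v
      linarith
  obtain ⟨F, hF⟩ := exists_int_chain
    (P := fun k (S : Finset (Fin n)) => S.card = m ∧
      LowerRiesz (fun i => T (τ k) (EuclideanSpace.single i 1)) S (1 / 11))
    (Q := fun k S S' => Disjoint S S' ∧ ∀ t, h t ∈ Icc (k : ℝ) (k + 1) →
      ∀ v : EuclideanSpace ℝ (Fin n), (∀ i ∉ S ∪ S', v i = 0) → 1 / 33 * ‖v‖ ≤ ‖T t v‖)
    (by
      obtain ⟨S, h1, _, h2, _⟩ := hsel 0 ∅ (by simp) lowerRiesz_empty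
      exact ⟨S, h1, h2⟩)
    (fun k S hS => by
      have h0 : |h (τ k) - h (τ (k + 1))| ≤ 1 := by rw [hτ, hτ]; push_cast; norm_num
      obtain ⟨S', h1, h2, h3, h4⟩ := hsel (k + 1) S hS.1.le (htrans h0 hS.2)
      refine ⟨S', ⟨h1, h3⟩, h2, fun t ht => hjoint ?_ h4⟩
      rw [hτ, abs_le]; push_cast
      constructor <;> linarith [ht.1, ht.2])
    (fun k S hS => by
      have h0 : |h (τ (k + 1)) - h (τ k)| ≤ 1 := by rw [hτ, hτ]; push_cast; norm_num
      obtain ⟨S', h1, h2, h3, h4⟩ := hsel k S hS.1.le (htrans h0 hS.2)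
      rw [Finset.union_comm] at h4
      refine ⟨S', ⟨h1, h3⟩, h2.symm, fun t ht => hjoint ?_ h4⟩
      rw [hτ, abs_le]
      constructor <;> linarith [ht.1, ht.2])
  let e : ∀ k, Fin m ↪o Fin n := fun k => (F k).orderEmbOfFin (hF k).1.1
  have he : ∀ k l, e k l ∈ F k := fun k l => Finset.orderEmbOfFin_mem _ _ _
  have hne : ∀ k l l', e k l ≠ e (k + 1) l' := fun k l l' heq =>
    Finset.disjoint_left.1 (hF k).2.1 (he k l) (heq ▸ he (k + 1) l')
  have hfr : ∀ s : ℝ, 0 ≤ 1 - Int.fract s := fun s => sub_nonneg.2 (Int.fract_lt_one s).le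
  have hfr' : ∀ s : ℝ, 0 ≤ 1 - (1 - Int.fract s) := fun s => by
    rw [sub_sub_cancel]; exact Int.fract_nonneg s
  clear_value e
  have horth : ∀ s, Orthonormal ℝ (interpolation (fun k => e k) s) := fun s =>
    orthonormal_combination (e ⌊s⌋).injective (e (⌊s⌋ + 1)).injective (hne ⌊s⌋)
      (by rw [Real.sq_sqrt (hfr s), Real.sq_sqrt (hfr' s)]; ring)
  refine ⟨fun t => Submodule.span ℝ (range (interpolation (fun k => e k) (h t))),
    fun t => ?_, ?_, fun t v hv => ?_, fun t => ?_⟩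
  · rw [finrank_span_eq_card (horth _).linearIndependent, Fintype.card_fin]
  · exact Orthonormal.continuous_starProjection_span (fun t => horth (h t))
      fun j => (continuous_interpolation (fun k => e k) j).comp hh
  · refine (hF ⌊h t⌋).2.2 t ⟨Int.floor_le _, (Int.lt_floor_add_one _).le⟩ v fun i hi => ?_
    rw [Finset.mem_union, not_or] at hi
    induction hv using Submodule.span_induction with
    | mem v hv =>
      obtain ⟨l, rfl⟩ := hv
      have h1 : i ≠ e ⌊h t⌋ l := fun heq => hi.1 (heq ▸ he _ _)
      have h2 : i ≠ e (⌊h t⌋ + 1) l := fun heq => hi.2 (heq ▸ he _ _)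
      simp [interpolation, h1, h2]
    | zero => rfl
    | add u v _ _ hu hv => simp [hu, hv]
    | smul a u _ hu => simp [hu]
  -- The unsimplified weight `1 - (1 - Int.fract s)` in `interpolation` makes `rfl` succeed here.
  · refine ⟨e ⌊h t⌋, e (⌊h t⌋ + 1), 1 - Int.fract (h t), ?_, ⟨hfr _, ?_⟩, rfl⟩
    · rw [Set.disjoint_left]
      rintro _ ⟨l, rfl⟩ ⟨l', hl'⟩
      exact hne _ _ _ hl'.symm
    · linarith [Int.fract_nonneg (h t)]

theorem norm_le_of_norm_single_le_one {n : ℕ}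
    {T : EuclideanSpace ℝ (Fin n) →L[ℝ] EuclideanSpace ℝ (Fin n)}
    (hT : ∀ i, ‖T (EuclideanSpace.single i 1)‖ ≤ 1) : ‖T‖ ≤ n := by
  refine T.opNorm_le_bound (Nat.cast_nonneg n) fun v => ?_
  conv_lhs => rw [← EuclideanSpace.sum_smul_single v, map_sum]
  refine (norm_sum_le _ _).trans ?_
  have : ∀ i ∈ Finset.univ, ‖T (v i • EuclideanSpace.single i 1)‖ ≤ ‖v‖ := fun i _ => by
    rw [map_smul, norm_smul]
    exact (mul_le_of_le_one_right (norm_nonneg _) (hT i)).trans (PiLp.norm_apply_le v i)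
  simpa using Finset.sum_le_card_nsmul _ _ _ this

theorem theorem1p6 (n : ℕ) (hn : 1 ≤ n) (A : ℝ → Matrix (Fin n) (Fin n) ℝ)
    (hA : Continuous A)
    (hcol : ∀ (t : ℝ) (i : Fin n),
      ‖Matrix.toEuclideanCLM (𝕜 := ℝ) (A t) (EuclideanSpace.single i (1 : ℝ))‖ = 1) :
    ∃ (m : ℕ) (U : ℝ → Submodule ℝ (EuclideanSpace ℝ (Fin n))),
      (2 : ℝ) ^ (-15 : ℤ) / 100 * (n : ℝ) / (⨆ t : ℝ, euclideanOpNorm (A t)) ^ 4 ≤ (m : ℝ) ∧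
      (∀ t : ℝ, Module.finrank ℝ (U t) = m) ∧
      IsContinuousFamily U ∧
      (∀ t : ℝ, ∀ v ∈ U t,
        (1 / 33 : ℝ) * ‖v‖ ≤ ‖Matrix.toEuclideanCLM (𝕜 := ℝ) (A t) v‖) ∧
      (2 ≤ n → ∀ t : ℝ, IsQuadraticConvexCombination m (U t)) := by
  -- An unbounded real supremum would take the default value 0; unit columns bound the norms by `n`.
  have hbdd : BddAbove (Set.range fun t => euclideanOpNorm (A t)) :=
    ⟨n, by
      rintro _ ⟨t, rfl⟩
      exact norm_le_of_norm_single_le_one fun i => (hcol t i).le⟩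
  set L := ⨆ t : ℝ, euclideanOpNorm (A t) with hLdef
  have hL : ∀ t, ‖Matrix.toEuclideanCLM (𝕜 := ℝ) (A t)‖ ≤ L := fun t => le_ciSup hbdd t
  let i₀ : Fin n := ⟨0, hn⟩
  have hL1 : 1 ≤ L := by
    refine le_trans ?_ (hL 0)
    have := (Matrix.toEuclideanCLM (𝕜 := ℝ) (A 0)).le_opNorm (EuclideanSpace.single i₀ 1)
    rwa [hcol, PiLp.norm_single, norm_one, mul_one] at this
  set q := (2 : ℝ) ^ (-15 : ℤ) / 100 * (n : ℝ) / L ^ 4 with hq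
  -- If `q ≤ 1`, a fixed coordinate line suffices, also for `n = 1`. Otherwise `⌈q⌉₊ ≤ 2 * q`, and
  -- `L ≥ 1` lets the weaker requirement of order `n / L ^ 2` follow with ample room.
  rcases le_or_gt q 1 with hq1 | hq1
  · refine ⟨1, fun _ => Submodule.span ℝ {EuclideanSpace.single i₀ 1}, by simpa using hq1,
      fun _ => finrank_span_singleton (by simp), ?_, fun t v hv => ?_,
      fun hn2 _ => ?_⟩
    · unfold IsContinuousFamily
      exact continuous_const (y := (Submodule.span ℝ {EuclideanSpace.single i₀ (1 : ℝ)}).starProjection)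
    · obtain ⟨a, rfl⟩ := Submodule.mem_span_singleton.1 hv
      rw [map_smul, norm_smul, norm_smul, hcol, PiLp.norm_single, norm_one]
      linarith [norm_nonneg a]
    · refine ⟨OrderEmbedding.ofStrictMono (fun _ => i₀) (Subsingleton.strictMono _),
        OrderEmbedding.ofStrictMono (fun _ => ⟨1, hn2⟩) (Subsingleton.strictMono _), 1, ?_,
        by norm_num, ?_⟩
      · rw [Set.disjoint_left]
        rintro _ ⟨_, rfl⟩ ⟨_, h⟩
        simpa [i₀] using congrArg Fin.val h
      · simp
  · have hm0 : ⌈q⌉₊ ≠ 0 := (Nat.ceil_pos.2 (by linarith)).ne'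
    have hm : (⌈q⌉₊ : ℝ) ≤ 2 * q := by
      have := (Nat.ceil_lt_add_one (by linarith : 0 ≤ q)).le
      linarith
    have hL2 : 1 ≤ L ^ 2 := one_le_pow₀ hL1
    have hqn : q * L ^ 2 ≤ (2 : ℝ) ^ (-15 : ℤ) / 100 * n := by
      have h1 : q * L ^ 2 * L ^ 2 = (2 : ℝ) ^ (-15 : ℤ) / 100 * n := by
        rw [hq]; field_simp
      rw [← h1]
      exact le_mul_of_one_le_right (by positivity) hL2
    have hfin : 600 * (⌈q⌉₊ : ℝ) * L ^ 2 ≤ n := by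
      have h1 : 600 * (⌈q⌉₊ : ℝ) * L ^ 2 ≤ 1200 * (q * L ^ 2) := by nlinarith
      have h2 : (0 : ℝ) ≤ n := Nat.cast_nonneg n
      norm_num at hqn
      linarith
    have hcont : Continuous fun t => Matrix.toEuclideanCLM (𝕜 := ℝ) (A t) :=
      (LinearMap.continuous_of_finiteDimensional
        (Matrix.toEuclideanCLM (n := Fin n) (𝕜 := ℝ)).toAlgEquiv.toLinearMap).comp hA
    obtain ⟨U, h1, h2, h3, h4⟩ := exists_continuous_family hm0 hcont hcol (by linarith) hL hfin
    exact ⟨⌈q⌉₊, U, Nat.le_ceil q, h1, h2, h3, fun _ => h4⟩
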